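/- Let $k$ be a field, let $I\subseteq S=k[x_1,\dots,x_n]$ be a monomial ideal, let $G(I)$ be its minimal set of monomial generators, and suppose that all elements of $G(I)$ have degree $d$. Let $L(I)$ be the lcm-lattice of $I$, i.e. the set of least common multiples of all subsets of $G(I)$ (with $1$ as the lcm of the empty set), ordered by divisibility; write $a\prec b$ if $b$ covers $a$. Then $I$ has linear quotients if and only if $L(I)$ is $d$-degree graded and CL-shellable. Here: - $I$ has linear quotients if $G(I)$ can be ordered $m_1,\dots,m_r$ so that for every $1\le i\le r$ the colon ideal $((m_1,\dots,m_{i-1}):m_i)$ is generated by a (possibly empty) set of variables. - $L(I)$ is $d$-degree graded if $\deg b=\deg a+1$ for all $a,b\in L(I)$ with $a\ne 1$ and $a\prec b$, and all atoms of $L(I)$ have degree $d$. - A finite poset is graded if it is bounded and all its maximal chains have the same length. It is CL-shellable if it is graded and admits a recursive atom ordering. A graded poset $P$ admits a recursive atom ordering if either it has no elements other than $\hat 0,\hat 1$, or there is an ordering $a_1,\dots,a_t$ of its atoms such that (i) for all $1\le j\le t$ the interval $[a_j,\hat 1]$ admits a recursive atom ordering in which the atoms of $[a_j,\hat 1]$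 that cover some $a_i$ with $i<j$ come before those that do not; and (ii) for all $1\le i<j\le t$ there is $l<j$ such that for every $y\in P$ with $a_i,a_j\le y$ there is $z\in P$ with $a_l\prec z$, $a_j\prec z$ and $z\le y$. -/

import Mathlib

namespace LinQuot

/-! ### Monomial ideals

A monomial of `k[x_i : i ∈ σ]` is represented by its exponent vector `s : σ →₀ ℕ`; the corresponding
polynomial is `MvPolynomial.monomial s 1`. Divisibility of monomials is the pointwise order on
exponent vectors, the least common multiple is `⊔`, and the degree is `Finsupp.degree`. -/

section Ideals

variable {σ k : Type*} [Field k]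

/-- `I` is a monomial ideal: it is generated by monomials. -/
def IsMonomialIdeal (I : Ideal (MvPolynomial σ k)) : Prop :=
  ∃ S : Set (σ →₀ ℕ), I = Ideal.span ((fun s => MvPolynomial.monomial s (1 : k)) '' S)

/-- `G(I)`: the minimal monomial generators of `I`, that is, the monomials in `I` that are minimal
with respect to divisibility. -/
def minGens (I : Ideal (MvPolynomial σ k)) : Set (σ →₀ ℕ) :=
  {s | Minimal (fun t => MvPolynomial.monomial t (1 : k) ∈ I) s}

/-- `I` is generated in degree `d`: every element of `G(I)` has degree `d`. -/
def GeneratedInDegree (d : ℕ) (I : Ideal (MvPolynomial σ k)) : Prop :=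
  ∀ s ∈ minGens I, s.degree = d

/-- `I` has linear quotients: there is an ordering `u 0, u 1, …` of `G(I)` such that every colon
ideal `((u 0, …, u (i-1)) : u i)` is generated by a set of variables. -/
def HasLinearQuotients (I : Ideal (MvPolynomial σ k)) : Prop :=
  ∃ (r : ℕ) (u : Fin r → (σ →₀ ℕ)), Function.Injective u ∧ Set.range u = minGens I ∧
    ∀ i : Fin r, ∃ V : Set σ,
      (Ideal.span ((fun j => MvPolynomial.monomial (u j) (1 : k)) '' {j | j < i})).colon
          {MvPolynomial.monomial (u i) (1 : k)} =
        Ideal.span ((fun v => (MvPolynomial.X v : MvPolynomial σ k)) '' V)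

/-- The lcm-lattice `L(I)`: all least common multiples of (finite) subsets of `G(I)`, ordered by
divisibility. -/
def LcmLattice (I : Ideal (MvPolynomial σ k)) : Type _ :=
  {m : σ →₀ ℕ // ∃ T : Finset (σ →₀ ℕ), (T : Set (σ →₀ ℕ)) ⊆ minGens I ∧ m = T.sup id}

instance (I : Ideal (MvPolynomial σ k)) : PartialOrder (LcmLattice I) :=
  inferInstanceAs (PartialOrder {m : σ →₀ ℕ //
    ∃ T : Finset (σ →₀ ℕ), (T : Set (σ →₀ ℕ)) ⊆ minGens I ∧ m = T.sup id})

/-- The minimal element of `L(I)` is the monomial `1`, the lcm of the empty set. -/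
instance (I : Ideal (MvPolynomial σ k)) : OrderBot (LcmLattice I) where
  bot := ⟨0, ∅, by simp, by simp [bot_eq_zero]⟩
  bot_le m := show (0 : σ →₀ ℕ) ≤ m.1 from zero_le

/-- The degree of an element of `L(I)`, as a monomial. -/
noncomputable def LcmLattice.deg {I : Ideal (MvPolynomial σ k)} (m : LcmLattice I) : ℕ :=
  Finsupp.degree m.1

/-- `L(I)` is `d`-degree graded: `deg b = deg a + 1` whenever `a ≠ 1` and `b` covers `a`, and all
atoms have degree `d`. -/
def IsDegreeGraded (d : ℕ) (I : Ideal (MvPolynomial σ k)) : Prop :=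
  (∀ a b : LcmLattice I, a ≠ ⊥ → a ⋖ b → b.deg = a.deg + 1) ∧
    ∀ a : LcmLattice I, IsAtom a → a.deg = d

end Ideals

/-! ### Recursive atom orderings -/

section Posets

variable {P : Type*} [PartialOrder P]

/-- A finite poset is graded if it is bounded and its order complex is pure, that is, all of its
maximal chains have the same number of elements. -/
def IsGradedPoset (P : Type*) [PartialOrder P] : Prop :=
  Finite P ∧ (∃ b : P, IsBot b) ∧ (∃ t : P, IsTop t) ∧
    ∃ r : ℕ, ∀ C : Set P, IsMaxChain (· ≤ ·) C → C.ncard = r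

/-- `IsRAO x a`: in a poset with greatest element `1`, the sequence `a` is a recursive atom ordering
of the interval `[x, 1]`. The atoms of `[x, 1]` are the elements covering `x`.
If `[x, 1]` has no elements other than `x` and `1`, then all the conditions on the (at most one)
atom hold automatically, so that this case needs no clause of its own. -/
inductive IsRAO : P → ∀ {t : ℕ}, (Fin t → P) → Prop
  | mk {x : P} {t : ℕ} (a : Fin t → P)
      (injective : Function.Injective a)
      (range_eq : Set.range a = {y | x ⋖ y})
      (len : Fin t → ℕ) (b : ∀ j : Fin t, Fin (len j) → P)
      (rao : ∀ j, IsRAO (a j) (b j))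
      (first : ∀ (j : Fin t) (p q : Fin (len j)),
        (∃ i < j, a i ⋖ b j p) → (¬ ∃ i < j, a i ⋖ b j q) → p < q)
      (exchange : ∀ i j : Fin t, i < j → ∃ l < j, ∀ y : P, a i ≤ y → a j ≤ y →
        ∃ z : P, a l ⋖ z ∧ a j ⋖ z ∧ z ≤ y) :
      IsRAO x a

/-- A poset is CL-shellable if it is graded and admits a recursive atom ordering. -/
def IsCLShellable (P : Type*) [PartialOrder P] [OrderBot P] : Prop :=
  IsGradedPoset P ∧ ∃ (t : ℕ) (a : Fin t → P), IsRAO (⊥ : P) a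

end Posets

end LinQuot

namespace LinQuot

/-! ### Exponent vectors and the exchange form of linear quotients. -/

section Exponents

variable {σ k : Type*} [Field k]

/-! Linear quotients amount to an exchange property, `LinearExchange`. In equal degree its `u l`
satisfies `u l : u j = x_v`, a variable dividing `u i : u j`.

Given the exchange property, `LinearExchange.exists_le_add_single` shows that each cover above a
nontrivial lcm multiplies it by one variable, so `L(I)` is degree graded. Two distinct covers of
such an element then have an lcm covering both. This semimodularity makes every ordering of the
atoms of an upper interval recursive, so the order required by (i) is free. Condition (ii) at the
bottom is the exchange property, with `z = lcm (u l, u j)`.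

Conversely, (ii) at the bottom with `y = lcm (a i, a j)` gives `z` covering `a j`; by the grading,
`z` is `a j` times a variable, which is the exchange property. -/

theorem degree_strictMono : StrictMono (Finsupp.degree : (σ →₀ ℕ) → ℕ) := by
  intro s t h
  obtain ⟨c, rfl⟩ := exists_add_of_le h.le
  have hc : Finsupp.degree c ≠ 0 := by
    intro h0
    rw [Finsupp.degree_eq_zero_iff] at h0
    simp [h0] at h
  rw [map_add]
  omega

theorem eq_of_le_of_degree_le {s t : σ →₀ ℕ} (h : s ≤ t) (hd : t.degree ≤ s.degree) : s = t := by
  by_contra hne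
  exact absurd (degree_strictMono (lt_of_le_of_ne h hne)) (not_lt.2 hd)

theorem eq_add_single_of_lt_of_le {s t : σ →₀ ℕ} {v : σ} (h : s < t)
    (ht : t ≤ s + Finsupp.single v 1) : t = s + Finsupp.single v 1 := by
  refine eq_of_le_of_degree_le ht ?_
  have := degree_strictMono h
  simp only [map_add, Finsupp.degree_single]
  omega

/-- In equal degree the cofactor has degree one, hence is a variable: dividing up to one variable is
a symmetric relation. -/
theorem le_add_single_of_le {s t : σ →₀ ℕ} {v : σ} (h : s ≤ t + Finsupp.single v 1)
    (hd : s.degree = t.degree) : ∃ w, t ≤ s + Finsupp.single w 1 := by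
  obtain ⟨c, hc⟩ := exists_add_of_le h
  have h1 : Finsupp.degree c = 1 := by
    have := congrArg Finsupp.degree hc
    simp only [map_add, Finsupp.degree_single] at this
    omega
  obtain ⟨w, hw⟩ : c ∈ Set.range (fun i : σ => Finsupp.single i 1) := by
    rw [Finsupp.range_single_one]
    exact h1
  refine ⟨w, ?_⟩
  simp only at hw
  rw [hw, ← hc]
  exact le_self_add

theorem add_single_le_sup {s t : σ →₀ ℕ} {v : σ} (h : s v < t v) :
    s + Finsupp.single v 1 ≤ t ⊔ s := by
  classical
  intro w
  by_cases hw : v = w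
  · subst hw
    simp only [Finsupp.add_apply, Finsupp.single_eq_same, Finsupp.sup_apply]
    exact le_sup_of_le_left h
  · simp [Finsupp.single_eq_of_ne' hw]

/-- The combinatorial form of linear quotients: for `i < j` there are `l < j` and a variable `v`
such that `u l : u j` divides `v` and `v` divides `u i : u j`. -/
def LinearExchange {r : ℕ} (u : Fin r → σ →₀ ℕ) : Prop :=
  ∀ i j, i < j → ∃ l < j, ∃ v, u j v < u i v ∧ u l ≤ u j + Finsupp.single v 1

theorem LinearExchange.of_colon {r : ℕ} {u : Fin r → σ →₀ ℕ}
    (h : ∀ i : Fin r, ∃ V : Set σ,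
      (Ideal.span ((fun j => MvPolynomial.monomial (u j) (1 : k)) '' {j | j < i})).colon
          {MvPolynomial.monomial (u i) (1 : k)} =
        Ideal.span ((fun v => (MvPolynomial.X v : MvPolynomial σ k)) '' V)) :
    LinearExchange u := by
  intro i j hij
  obtain ⟨V, hV⟩ := h j
  have himg : (fun j => MvPolynomial.monomial (u j) (1 : k)) '' {l | l < j} =
      (fun s => MvPolynomial.monomial s (1 : k)) '' (u '' {l | l < j}) := by
    rw [Set.image_image]
  rw [himg] at hV
  -- Truncated subtraction of exponents is the monomial `u i : u j`.
  have hmem : MvPolynomial.monomial (u i - u j) (1 : k) ∈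
      Ideal.span ((fun v => (MvPolynomial.X v : MvPolynomial σ k)) '' V) := by
    rw [← hV, Submodule.mem_colon_singleton, smul_eq_mul, MvPolynomial.monomial_mul, mul_one,
      MvPolynomial.mem_ideal_span_monomial_image]
    intro s hs
    rw [Finset.mem_singleton.1 (MvPolynomial.support_monomial_subset hs)]
    exact ⟨u i, ⟨i, hij, rfl⟩, le_tsub_add⟩
  obtain ⟨v, hvV, hv⟩ := MvPolynomial.mem_ideal_span_X_image.1 hmem (u i - u j)
    (by classical simp [MvPolynomial.support_monomial])
  have hX : (MvPolynomial.X v : MvPolynomial σ k) ∈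
      Ideal.span ((fun v => (MvPolynomial.X v : MvPolynomial σ k)) '' V) :=
    Ideal.subset_span ⟨v, hvV, rfl⟩
  rw [← hV, Submodule.mem_colon_singleton, smul_eq_mul, MvPolynomial.X,
    MvPolynomial.monomial_mul, mul_one, MvPolynomial.mem_ideal_span_monomial_image] at hX
  obtain ⟨_, ⟨l, hl, rfl⟩, hle⟩ := hX (Finsupp.single v 1 + u j)
    (by classical simp [MvPolynomial.support_monomial])
  refine ⟨l, hl, v, ?_, by rwa [add_comm]⟩
  simp only [Finsupp.tsub_apply] at hv
  omega

theorem LinearExchange.colon {r : ℕ} {u : Fin r → σ →₀ ℕ} (h : LinearExchange u) (i : Fin r) :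
    ∃ V : Set σ,
      (Ideal.span ((fun j => MvPolynomial.monomial (u j) (1 : k)) '' {j | j < i})).colon
          {MvPolynomial.monomial (u i) (1 : k)} =
        Ideal.span ((fun v => (MvPolynomial.X v : MvPolynomial σ k)) '' V) := by
  have himg : (fun j => MvPolynomial.monomial (u j) (1 : k)) '' {l | l < i} =
      (fun s => MvPolynomial.monomial s (1 : k)) '' (u '' {l | l < i}) := by
    rw [Set.image_image]
  rw [himg]
  refine ⟨{v | ∃ l < i, u l ≤ u i + Finsupp.single v 1}, le_antisymm ?_ ?_⟩
  · intro f hf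
    rw [Submodule.mem_colon_singleton, smul_eq_mul,
      MvPolynomial.mem_ideal_span_monomial_image] at hf
    refine MvPolynomial.mem_ideal_span_X_image.2 fun s hs => ?_
    obtain ⟨_, ⟨j, hj, rfl⟩, hle⟩ := hf (s + u i) (by
      rw [MvPolynomial.mem_support_iff, MvPolynomial.coeff_mul_monomial, mul_one]
      exact MvPolynomial.mem_support_iff.1 hs)
    obtain ⟨l, hl, v, hv, hlv⟩ := h j i hj
    refine ⟨v, ⟨l, hl, hlv⟩, ?_⟩
    have := hle v
    simp only [Finsupp.add_apply] at this
    omega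
  · rw [Ideal.span_le]
    rintro _ ⟨v, ⟨l, hl, hlv⟩, rfl⟩
    simp only [SetLike.mem_coe]
    rw [Submodule.mem_colon_singleton, smul_eq_mul, MvPolynomial.X, MvPolynomial.monomial_mul,
      mul_one, MvPolynomial.mem_ideal_span_monomial_image]
    intro s hs
    rw [Finset.mem_singleton.1 (MvPolynomial.support_monomial_subset hs)]
    exact ⟨u l, ⟨l, hl, rfl⟩, by rwa [add_comm]⟩

/-- If some `u j` divides `x` and `u i` does not, then some `u l` dividing `lcm (x, u i)` divides
`x` times a variable but not `x`. -/
theorem LinearExchange.exists_le_add_single {r d : ℕ} {u : Fin r → σ →₀ ℕ}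
    (h : LinearExchange u) (hd : ∀ i, (u i).degree = d) {x : σ →₀ ℕ} (i j : Fin r)
    (hi : ¬ u i ≤ x) (hj : u j ≤ x) :
    ∃ l v, ¬ u l ≤ x ∧ u l ≤ x + Finsupp.single v 1 ∧ u l ≤ x ⊔ u i := by
  induction hn : (i : ℕ) + j using Nat.strong_induction_on generalizing i j with
  | _ n ih =>
    subst hn
    rcases lt_trichotomy i j with hij | rfl | hij
    · obtain ⟨l, hl, v, hv, hle⟩ := h i j hij
      by_cases hlx : u l ≤ x
      · exact ih _ (by have : (l : ℕ) < j := hl; omega) i l hi hlx rfl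
      · refine ⟨l, v, hlx, hle.trans (by gcongr), (hle.trans (add_single_le_sup hv)).trans ?_⟩
        exact sup_le le_sup_right (hj.trans le_sup_left)
    · exact absurd hj hi
    · obtain ⟨l, hl, v, hv, hle⟩ := h j i hij
      by_cases hlx : u l ≤ x
      -- As `u l` divides `x`, symmetry of the exchange puts `u i` itself one variable away from
      -- `x`.
      · obtain ⟨w, hw⟩ := le_add_single_of_le hle ((hd l).trans (hd i).symm)
        exact ⟨i, w, hi, hw.trans (by gcongr), le_sup_right⟩
      · obtain ⟨m, w, hm, hmw, hle'⟩ :=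
          ih _ (by have : (l : ℕ) < i := hl; omega) l j hlx hj rfl
        refine ⟨m, w, hm, hmw, hle'.trans (sup_le le_sup_left ?_)⟩
        exact (hle.trans (add_single_le_sup hv)).trans
          (sup_le (hj.trans le_sup_left) le_sup_right)

end Exponents

/-! ### Semimodularity, recursive atom orderings and maximal chains. -/

section Posets

variable {P : Type*} [PartialOrder P]

theorem exists_enumeration_with_first {α : Type*} {S : Set α} (hS : S.Finite) (p : α → Prop) :
    ∃ (t : ℕ) (b : Fin t → α), Function.Injective b ∧ Set.range b = S ∧
      ∀ i j, p (b i) → ¬ p (b j) → i < j := by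
  classical
  have hS₁ : (S ∩ {x | p x}).Finite := hS.inter_of_left _
  have hS₂ : (S ∩ {x | ¬ p x}).Finite := hS.inter_of_left _
  obtain ⟨m₁, b₁, hb₁, hr₁⟩ := hS₁.fin_param
  obtain ⟨m₂, b₂, hb₂, hr₂⟩ := hS₂.fin_param
  have h₁ (i) : b₁ i ∈ S ∩ {x | p x} := hr₁ ▸ Set.mem_range_self i
  have h₂ (i) : b₂ i ∈ S ∩ {x | ¬ p x} := hr₂ ▸ Set.mem_range_self i
  refine ⟨m₁ + m₂, Fin.append b₁ b₂, ?_, ?_, ?_⟩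
  · rw [Fin.append_injective_iff]
    refine ⟨hb₁, hb₂, fun i j hij => (h₂ j).2 ?_⟩
    rw [← hij]
    exact (h₁ i).2
  · ext x
    constructor
    · rintro ⟨i, rfl⟩
      refine Fin.addCases (fun i => ?_) (fun i => ?_) i
      · simpa using (h₁ i).1
      · simpa using (h₂ i).1
    · intro hx
      by_cases hp : p x
      · obtain ⟨i, rfl⟩ : x ∈ Set.range b₁ := hr₁ ▸ ⟨hx, hp⟩
        exact ⟨Fin.castAdd m₂ i, by simp⟩
      · obtain ⟨i, rfl⟩ : x ∈ Set.range b₂ := hr₂ ▸ ⟨hx, hp⟩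
        exact ⟨Fin.natAdd m₁ i, by simp⟩
  · intro i j
    refine Fin.addCases (fun i => ?_) (fun i => ?_) i
    · refine Fin.addCases (fun j => ?_) (fun j => ?_) j
      · intro _ h
        rw [Fin.append_left] at h
        exact absurd (h₁ j).2 h
      · intro _ _
        simp only [Fin.lt_def, Fin.val_castAdd, Fin.val_natAdd]
        omega
    · intro h
      rw [Fin.append_right] at h
      exact absurd h (h₂ i).2

/-- The interval `[x, 1]` is upper semimodular, in the strong sense that two distinct covers of
one element have a common cover below each common upper bound. -/
def UpperSemimodularAbove (x : P) : Prop :=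
  ∀ w y y' z : P, x ≤ w → w ⋖ y → w ⋖ y' → y ≠ y' → y ≤ z → y' ≤ z →
    ∃ c, y ⋖ c ∧ y' ⋖ c ∧ c ≤ z

/-- Condition (ii) holds with `l = i` for any ordering, so each upper interval may be reordered to
meet (i). -/
theorem UpperSemimodularAbove.isRAO [Finite P] {x : P} (h : UpperSemimodularAbove x) {t : ℕ}
    (a : Fin t → P) (hinj : Function.Injective a) (hrange : Set.range a = {y | x ⋖ y}) :
    IsRAO x a := by
  induction x using WellFoundedGT.induction generalizing t with
  | _ x ih =>
    have hcov (j) : x ⋖ a j := hrange.subset (Set.mem_range_self j)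
    choose len b hbinj hbrange hb using fun j =>
      exists_enumeration_with_first (Set.toFinite {y | a j ⋖ y}) (fun y => ∃ i < j, a i ⋖ y)
    refine IsRAO.mk a hinj hrange len b (fun j => ?_) hb fun i j hij => ⟨i, hij, fun y hi hj => ?_⟩
    · exact ih _ (hcov j).lt (fun w y y' z hw => h w y y' z ((hcov j).le.trans hw)) _ (hbinj j)
        (hbrange j)
    · exact h x _ _ y le_rfl (hcov i) (hcov j) (hinj.ne hij.ne) hi hj

/-- The rank `g` maps a maximal chain bijectively onto `0, …, g t`: chain elements on either side of
a skipped value would form a cover in `P`, where `g` rises by one only. -/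
theorem ncard_eq_of_isMaxChain [Finite P] [OrderBot P] {t : P} (ht : IsTop t) {g : P → ℕ}
    (hmono : StrictMono g) (hbot : g ⊥ = 0) (hg : ∀ a b, a ⋖ b → g b = g a + 1) {C : Set P}
    (hC : IsMaxChain (· ≤ ·) C) : C.ncard = g t + 1 := by
  have hcomp {a b : P} (ha : a ∈ C) (hb : b ∈ C) : a ≤ b ∨ b ≤ a := hC.isChain.total ha hb
  have hmem {x : P} (hx : ∀ c ∈ C, x ≤ c ∨ c ≤ x) : x ∈ C := by
    have hins : IsChain (· ≤ ·) (insert x C) := hC.isChain.insert fun c hc _ => hx c hc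
    rw [hC.2 hins (Set.subset_insert x C)]
    exact Set.mem_insert x C
  have hinj : Set.InjOn g C := by
    intro a ha b hb hab
    rcases hcomp ha hb with hle | hle
    · exact hle.eq_of_not_lt fun hlt => (hmono hlt).ne hab
    · exact (hle.eq_of_not_lt fun hlt => (hmono hlt).ne hab.symm).symm
  have himg : g '' C = Set.Iic (g t) := by
    apply subset_antisymm
    · rintro _ ⟨c, _, rfl⟩
      exact hmono.monotone (ht c)
    · intro e he
      have htC : t ∈ C := hmem fun c _ => .inr (ht c)
      rcases eq_or_lt_of_le (Set.mem_Iic.1 he) with rfl | he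
      · exact ⟨t, htC, rfl⟩
      obtain ⟨c, ⟨hcC, hce⟩, hmax⟩ := Set.Finite.exists_maximalFor g {c | c ∈ C ∧ g c ≤ e}
        (Set.toFinite _) ⟨⊥, hC.bot_mem, by simp [hbot]⟩
      obtain ⟨b, ⟨hbC, heb⟩, hmin⟩ := Set.Finite.exists_minimalFor g {c | c ∈ C ∧ e < g c}
        (Set.toFinite _) ⟨t, htC, he⟩
      refine ⟨c, hcC, hce.antisymm (not_lt.1 fun hlt => ?_)⟩
      have hcb : c < b := by
        refine lt_of_le_of_ne ((hcomp hcC hbC).resolve_right fun hle => ?_) ?_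
        · exact absurd (hmono.monotone hle) (by omega)
        · rintro rfl
          omega
      have hcov : c ⋖ b := by
        refine ⟨hcb, fun x hcx hxb => ?_⟩
        have hx : x ∈ C := by
          refine hmem fun y hy => ?_
          rcases le_or_gt (g y) e with hye | hye
          · refine .inr (le_trans ?_ hcx.le)
            rcases hcomp hy hcC with hle | hle
            · exact hle
            · exact (hle.eq_of_not_lt fun h =>
                absurd (hmono h) (not_lt.2 (hmax ⟨hy, hye⟩ (hmono.monotone hle)))).ge
          · refine .inl (hxb.le.trans ?_)
            rcases hcomp hy hbC with hle | hle
            · exact (hle.eq_of_not_lt fun h =>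
                absurd (hmono h) (not_lt.2 (hmin ⟨hy, hye⟩ (hmono.monotone hle)))).ge
            · exact hle
        rcases le_or_gt (g x) e with hxe | hxe
        · exact absurd (hmono hcx) (not_lt.2 (hmax ⟨hx, hxe⟩ (hmono hcx).le))
        · exact absurd (hmono hxb) (not_lt.2 (hmin ⟨hx, hxe⟩ (hmono hxb).le))
      have := hg _ _ hcov
      omega
  rw [← hinj.ncard_image, himg]
  simp [Set.ncard_eq_toFinset_card']

end Posets

/-! ### The lcm-lattice and its grading. -/

section LcmLattice

variable {σ k : Type*} [Field k] {I : Ideal (MvPolynomial σ k)}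

/-- A minimal generator, as an element of the lcm-lattice. -/
def LcmLattice.ofGen (m : σ →₀ ℕ) (hm : m ∈ minGens I) : LcmLattice I :=
  ⟨m, {m}, by simpa using hm, by simp⟩

/-- The least common multiple of two elements of the lcm-lattice. -/
noncomputable def LcmLattice.lcm (a b : LcmLattice I) : LcmLattice I :=
  ⟨a.1 ⊔ b.1, by
    classical
    obtain ⟨S, hS, ha⟩ := a.2
    obtain ⟨T, hT, hb⟩ := b.2
    exact ⟨S ∪ T, by simp [hS, hT], by rw [Finset.sup_union, ha, hb]⟩⟩

theorem LcmLattice.le_def {a b : LcmLattice I} : a ≤ b ↔ a.1 ≤ b.1 := Iff.rfl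

theorem LcmLattice.lcm_le {a b c : LcmLattice I} (ha : a ≤ c) (hb : b ≤ c) : a.lcm b ≤ c :=
  sup_le (α := σ →₀ ℕ) ha hb

theorem LcmLattice.le_lcm_left (a b : LcmLattice I) : a ≤ a.lcm b :=
  le_sup_left (α := σ →₀ ℕ)

theorem LcmLattice.le_lcm_right (a b : LcmLattice I) : b ≤ a.lcm b :=
  le_sup_right (α := σ →₀ ℕ)

theorem LcmLattice.deg_strictMono : StrictMono (LcmLattice.deg : LcmLattice I → ℕ) :=
  fun _ _ h => degree_strictMono (σ := σ) h

theorem LcmLattice.eq_of_le_of_deg_le {a b : LcmLattice I} (h : a ≤ b) (hd : b.deg ≤ a.deg) :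
    a = b :=
  h.eq_of_not_lt fun hlt => absurd (LcmLattice.deg_strictMono hlt) (not_lt.2 hd)

theorem LcmLattice.covBy_of_lt_of_deg_le {a b : LcmLattice I} (h : a < b)
    (hd : b.deg ≤ a.deg + 1) : a ⋖ b :=
  ⟨h, fun c hac hcb => by
    have := LcmLattice.deg_strictMono hac
    have := LcmLattice.deg_strictMono hcb
    omega⟩

theorem LcmLattice.exists_gen_of_not_le {a : LcmLattice I} {x : σ →₀ ℕ} (h : ¬ a.1 ≤ x) :
    ∃ m ∈ minGens I, m ≤ a.1 ∧ ¬ m ≤ x := by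
  obtain ⟨T, hT, ha⟩ := a.2
  by_contra! hc
  refine h ?_
  rw [ha]
  refine Finset.sup_le fun m hm => hc m (hT hm) ?_
  rw [ha]
  exact Finset.le_sup (f := id) hm

theorem LcmLattice.exists_gen_of_ne_bot {a : LcmLattice I} (h : a ≠ ⊥) :
    ∃ m ∈ minGens I, m ≤ a.1 := by
  obtain ⟨m, hm, hma, -⟩ := LcmLattice.exists_gen_of_not_le (a := a) (x := 0)
    fun h0 => h (le_bot_iff.1 h0)
  exact ⟨m, hm, hma⟩

theorem LcmLattice.finite (h : (minGens I).Finite) : Finite (LcmLattice I) := by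
  classical
  refine Set.Finite.subset (h.toFinset.powerset.image fun T => T.sup id).finite_toSet ?_
  rintro m ⟨T, hT, rfl⟩
  exact Finset.mem_coe.2 <| Finset.mem_image.2
    ⟨T, Finset.mem_powerset.2 fun m hm => h.mem_toFinset.2 (hT hm), rfl⟩

theorem LcmLattice.exists_isTop (h : (minGens I).Finite) : ∃ t : LcmLattice I, IsTop t := by
  refine ⟨⟨h.toFinset.sup id, h.toFinset, h.coe_toFinset.subset, rfl⟩, ?_⟩
  rintro ⟨_, T, hT, rfl⟩
  exact Finset.sup_mono (α := σ →₀ ℕ) (f := id) (fun m hm => h.mem_toFinset.2 (hT hm))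

variable {d : ℕ}

theorem GeneratedInDegree.subsingleton (hd : GeneratedInDegree 0 I) :
    Subsingleton (LcmLattice I) := by
  refine ⟨fun a b => ?_⟩
  have h (a : LcmLattice I) : a = ⊥ := by
    obtain ⟨T, hT, ha⟩ := a.2
    refine le_bot_iff.1 ?_
    rw [LcmLattice.le_def, ha]
    refine Finset.sup_le fun m hm => ?_
    exact ((Finsupp.degree_eq_zero_iff m).1 (hd m (hT hm))).le
  rw [h a, h b]

theorem GeneratedInDegree.le_deg (hd : GeneratedInDegree d I) {a : LcmLattice I} (h : a ≠ ⊥) :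
    d ≤ a.deg := by
  obtain ⟨m, hm, hma⟩ := LcmLattice.exists_gen_of_ne_bot h
  rw [← hd m hm]
  exact degree_strictMono.monotone hma

/-- The case `d = 0` must be excluded: there the only possible generator is `1`, the bottom itself.
-/
theorem GeneratedInDegree.bot_covBy_iff (hd : GeneratedInDegree d I) (h0 : d ≠ 0)
    {a : LcmLattice I} : ⊥ ⋖ a ↔ a.1 ∈ minGens I := by
  constructor
  · intro h
    obtain ⟨m, hm, hma⟩ := LcmLattice.exists_gen_of_ne_bot h.lt.ne'
    have hle : LcmLattice.ofGen m hm ≤ a := hma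
    have hpos : ⊥ < LcmLattice.ofGen m hm := by
      refine bot_lt_iff_ne_bot.2 fun hbot => h0 ?_
      rw [← hd m hm, show m = 0 from congrArg Subtype.val hbot, map_zero]
    rw [← hle.eq_of_not_lt (h.2 hpos)]
    exact hm
  · intro ha
    have hdeg : a.deg = d := hd _ ha
    refine ⟨bot_lt_iff_ne_bot.2 ?_, fun c hc hca => ?_⟩
    · rintro rfl
      exact h0 (by rw [← hdeg]; exact map_zero _)
    · have h₁ := hd.le_deg hc.ne'
      have h₂ := LcmLattice.deg_strictMono hca
      omega

theorem isGradedPoset_of_isDegreeGraded (hd : GeneratedInDegree d I)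
    (hfin : (minGens I).Finite) (h : IsDegreeGraded d I) : IsGradedPoset (LcmLattice I) := by
  classical
  have := LcmLattice.finite hfin
  obtain ⟨t, ht⟩ := LcmLattice.exists_isTop hfin
  -- The shift closes the jump from degree `0` to degree `d`: atoms get rank `1`.
  let g (a : LcmLattice I) : ℕ := if a = ⊥ then 0 else a.deg + 1 - d
  have hmono : StrictMono g := by
    intro a b hab
    have hb : b ≠ ⊥ := hab.ne_bot
    have := hd.le_deg hb
    have := LcmLattice.deg_strictMono hab
    by_cases ha : a = ⊥
    · simp only [g, ha, hb, if_true, if_false]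
      omega
    · have := hd.le_deg ha
      simp only [g, ha, hb, if_false]
      omega
  refine ⟨this, ⟨⊥, isBot_bot⟩, ⟨t, ht⟩, g t + 1, fun C hC =>
    ncard_eq_of_isMaxChain ht hmono (by simp [g]) (fun a b hab => ?_) hC⟩
  have hb : b ≠ ⊥ := hab.lt.ne_bot
  by_cases ha : a = ⊥
  · subst ha
    have := h.2 b (bot_covBy_iff.1 hab)
    simp only [g, hb, if_true, if_false]
    omega
  · have := hd.le_deg ha
    have := h.1 a b ha hab
    simp only [g, ha, hb, if_false]
    omega

/-! ### From linear quotients to a recursive atom ordering. -/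

variable {r : ℕ} {u : Fin r → σ →₀ ℕ}

theorem LinearExchange.exists_add_single_of_covBy (hu : LinearExchange u)
    (hrange : Set.range u = minGens I) (hd : GeneratedInDegree d I) {a b : LcmLattice I}
    (ha : a ≠ ⊥) (hab : a ⋖ b) : ∃ v, b.1 = a.1 + Finsupp.single v 1 := by
  have hmem (i) : u i ∈ minGens I := hrange ▸ Set.mem_range_self i
  obtain ⟨m, hm, hmb, hma⟩ := LcmLattice.exists_gen_of_not_le (a := b) (x := a.1) hab.lt.not_ge
  obtain ⟨m', hm', hma'⟩ := LcmLattice.exists_gen_of_ne_bot ha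
  obtain ⟨i, rfl⟩ := hrange.ge hm
  obtain ⟨j, rfl⟩ := hrange.ge hm'
  obtain ⟨l, v, hl, hlv, hli⟩ :=
    hu.exists_le_add_single (fun i => hd _ (hmem i)) i j hma hma'
  refine ⟨v, eq_add_single_of_lt_of_le hab.lt ?_⟩
  -- This lcm lies strictly above `a` and below `b`, so it is `b`; it also divides `a` times `x_v`.
  let c := a.lcm (LcmLattice.ofGen (u l) (hmem l))
  have hac : a < c := by
    refine lt_of_le_not_ge (a.le_lcm_left _) fun h => hl ?_
    exact ((a.le_lcm_right (LcmLattice.ofGen (u l) (hmem l))).trans h :)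
  have hcb : c ≤ b := LcmLattice.lcm_le hab.le (hli.trans (sup_le hab.le hmb))
  rw [← hcb.eq_of_not_lt (hab.2 hac)]
  exact sup_le le_self_add hlv

theorem LinearExchange.isDegreeGraded (hu : LinearExchange u)
    (hrange : Set.range u = minGens I) (hd : GeneratedInDegree d I) (h0 : d ≠ 0) :
    IsDegreeGraded d I := by
  refine ⟨fun a b ha hab => ?_, fun a ha => hd _ ((hd.bot_covBy_iff h0).1 (bot_covBy_iff.2 ha))⟩
  obtain ⟨v, hv⟩ := hu.exists_add_single_of_covBy hrange hd ha hab
  rw [LcmLattice.deg, LcmLattice.deg, hv, map_add, Finsupp.degree_single]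

theorem LinearExchange.upperSemimodularAbove (hu : LinearExchange u)
    (hrange : Set.range u = minGens I) (hd : GeneratedInDegree d I) {x : LcmLattice I}
    (hx : x ≠ ⊥) : UpperSemimodularAbove x := by
  intro w y y' z hxw hy hy' hne hyz hyz'
  have hw : w ≠ ⊥ := ((bot_lt_iff_ne_bot.2 hx).trans_le hxw).ne'
  obtain ⟨v, hv⟩ := hu.exists_add_single_of_covBy hrange hd hw hy
  obtain ⟨v', hv'⟩ := hu.exists_add_single_of_covBy hrange hd hw hy'
  have hdy : y.deg = w.deg + 1 := by
    rw [LcmLattice.deg, LcmLattice.deg, hv, map_add, Finsupp.degree_single]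
  have hdy' : y'.deg = w.deg + 1 := by
    rw [LcmLattice.deg, LcmLattice.deg, hv', map_add, Finsupp.degree_single]
  have hdc : (y.lcm y').deg ≤ w.deg + 2 := by
    have : (y.lcm y').1 ≤ w.1 + Finsupp.single v 1 + Finsupp.single v' 1 := by
      refine sup_le (hv.le.trans le_self_add) (hv'.le.trans ?_)
      gcongr
      exact le_self_add
    have := degree_strictMono.monotone this
    rwa [map_add, map_add, Finsupp.degree_single, Finsupp.degree_single] at this
  refine ⟨y.lcm y', LcmLattice.covBy_of_lt_of_deg_le ?_ (by omega),
    LcmLattice.covBy_of_lt_of_deg_le ?_ (by omega), LcmLattice.lcm_le hyz hyz'⟩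
  · refine (y.le_lcm_left y').lt_of_ne fun h => hne ?_
    exact (LcmLattice.eq_of_le_of_deg_le (h ▸ y.le_lcm_right y') (by omega)).symm
  · refine (y.le_lcm_right y').lt_of_ne fun h => hne ?_
    exact LcmLattice.eq_of_le_of_deg_le (h ▸ y.le_lcm_left y') (by omega)

theorem LinearExchange.exists_isRAO (hu : LinearExchange u) (hinj : Function.Injective u)
    (hrange : Set.range u = minGens I) (hd : GeneratedInDegree d I) (h0 : d ≠ 0) :
    ∃ (t : ℕ) (a : Fin t → LcmLattice I), IsRAO (⊥ : LcmLattice I) a := by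
  have : Finite (LcmLattice I) := LcmLattice.finite (hrange ▸ Set.finite_range u)
  have hmem (i) : u i ∈ minGens I := hrange ▸ Set.mem_range_self i
  let a (i : Fin r) : LcmLattice I := LcmLattice.ofGen (u i) (hmem i)
  have ha (i) : ⊥ ⋖ a i := (hd.bot_covBy_iff h0).2 (hmem i)
  have hainj : Function.Injective a := fun i j h => hinj (congrArg Subtype.val h)
  choose len b hbinj hbrange hb using fun j =>
    exists_enumeration_with_first (Set.toFinite {y | a j ⋖ y}) (fun y => ∃ i < j, a i ⋖ y)
  refine ⟨r, a, IsRAO.mk a hainj ?_ len b (fun j => ?_) hb fun i j hij => ?_⟩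
  · ext y
    refine ⟨?_, fun hy => ?_⟩
    · rintro ⟨i, rfl⟩
      exact ha i
    · obtain ⟨i, hi⟩ := hrange.ge ((hd.bot_covBy_iff h0).1 hy)
      exact ⟨i, Subtype.ext hi⟩
  · exact (hu.upperSemimodularAbove hrange hd (ha j).lt.ne').isRAO _ (hbinj j) (hbrange j)
  · obtain ⟨l, hl, v, hv, hle⟩ := hu i j hij
    have hdeg (i) : (a i).deg = d := hd _ (hmem i)
    have hdc : ((a l).lcm (a j)).deg ≤ d + 1 := by
      have : ((a l).lcm (a j)).1 ≤ u j + Finsupp.single v 1 := sup_le hle le_self_add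
      have := degree_strictMono.monotone this
      rwa [map_add, Finsupp.degree_single, hd _ (hmem j)] at this
    have hlj : a l ≠ a j := hainj.ne hl.ne
    refine ⟨l, hl, fun y hi hj => ⟨(a l).lcm (a j), ?_, ?_, LcmLattice.lcm_le ?_ hj⟩⟩
    · refine LcmLattice.covBy_of_lt_of_deg_le ?_ (by rwa [hdeg])
      refine ((a l).le_lcm_left (a j)).lt_of_ne fun h => hlj ?_
      exact (LcmLattice.eq_of_le_of_deg_le (h ▸ (a l).le_lcm_right (a j)) (by simp [hdeg])).symm
    · refine LcmLattice.covBy_of_lt_of_deg_le ?_ (by rwa [hdeg])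
      refine ((a l).le_lcm_right (a j)).lt_of_ne fun h => hlj ?_
      exact LcmLattice.eq_of_le_of_deg_le (h ▸ (a l).le_lcm_left (a j)) (by simp [hdeg])
    · exact (hle.trans (add_single_le_sup hv)).trans (sup_le hi hj)

theorem IsRAO.injective {P : Type*} [PartialOrder P] {x : P} {t : ℕ} {a : Fin t → P}
    (h : IsRAO x a) : Function.Injective a := by
  cases h
  assumption

theorem IsRAO.range_eq {P : Type*} [PartialOrder P] {x : P} {t : ℕ} {a : Fin t → P}
    (h : IsRAO x a) : Set.range a = {y | x ⋖ y} := by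
  cases h
  assumption

/-! ### From a recursive atom ordering back to linear quotients. -/

theorem linearExchange_of_isRAO (hgr : IsDegreeGraded d I)
    {t : ℕ} {a : Fin t → LcmLattice I} (h : IsRAO (⊥ : LcmLattice I) a) :
    LinearExchange fun i => (a i).1 := by
  obtain ⟨a, hinj, hrange, -, -, -, -, hex⟩ := h
  have ha (i) : ⊥ ⋖ a i := hrange.subset (Set.mem_range_self i)
  intro i j hij
  obtain ⟨l, hl, h⟩ := hex i j hij
  obtain ⟨z, hlz, hjz, hz⟩ := h ((a i).lcm (a j)) ((a i).le_lcm_left _) ((a i).le_lcm_right _)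
  have hdeg : z.deg = (a j).deg + 1 := hgr.1 _ _ (ha j).lt.ne' hjz
  obtain ⟨c, hc⟩ := exists_add_of_le (LcmLattice.le_def.1 hjz.le)
  have h1 : Finsupp.degree c = 1 := by
    have := congrArg Finsupp.degree hc
    rw [map_add] at this
    simp only [LcmLattice.deg] at hdeg
    omega
  obtain ⟨v, rfl⟩ : c ∈ Set.range (fun i : σ => Finsupp.single i 1) := by
    rw [Finsupp.range_single_one]
    exact h1
  refine ⟨l, hl, v, ?_, hc ▸ hlz.le⟩
  -- At `v`, `z` exceeds `a j`, so the bound by the lcm must come from `a i`.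
  have hv : z.1 v ≤ ((a i).1 ⊔ (a j).1) v := hz v
  rw [hc] at hv
  simp only [Finsupp.add_apply, Finsupp.single_eq_same, Finsupp.sup_apply] at hv
  show (a j).1 v < (a i).1 v
  rcases le_sup_iff.1 hv with hv | hv <;> omega

/-! ### Degree zero, where both sides hold trivially. -/

theorem GeneratedInDegree.hasLinearQuotients_zero (hd : GeneratedInDegree 0 I) :
    HasLinearQuotients I := by
  have hsub : minGens I ⊆ {0} := fun m hm => (Finsupp.degree_eq_zero_iff m).1 (hd m hm)
  rcases Set.subset_singleton_iff_eq.1 hsub with h | h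
  · exact ⟨0, Fin.elim0, fun i => i.elim0, by simp [h], fun i => i.elim0⟩
  · have hu : LinearExchange fun _ : Fin 1 => (0 : σ →₀ ℕ) :=
      fun i j hij => absurd hij (by simp [Subsingleton.elim i j])
    exact ⟨1, fun _ => 0, fun i j _ => Subsingleton.elim i j, by simp [h], hu.colon⟩

theorem isCLShellable_of_subsingleton {P : Type*} [PartialOrder P] [OrderBot P] [Subsingleton P] :
    IsCLShellable P := by
  refine ⟨⟨inferInstance, ⟨⊥, isBot_bot⟩, ⟨⊥, fun a => (Subsingleton.elim a ⊥).le⟩, 1,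
    fun C hC => ?_⟩, 0, Fin.elim0, ?_⟩
  · rw [Set.ncard_eq_one]
    exact ⟨⊥, Set.eq_singleton_iff_unique_mem.2
      ⟨hC.bot_mem, fun x _ => Subsingleton.elim x ⊥⟩⟩
  · refine IsRAO.mk Fin.elim0 (fun i => i.elim0) ?_ Fin.elim0 (fun i => i.elim0)
      (fun i => i.elim0) (fun i => i.elim0) (fun i => i.elim0)
    ext y
    exact ⟨fun ⟨i, _⟩ => i.elim0, fun hy => absurd (Subsingleton.elim ⊥ y) hy.lt.ne⟩

end LcmLattice

end LinQuot

theorem theorem2 {k : Type*} [Field k] {n d : ℕ} (I : Ideal (MvPolynomial (Fin n) k))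
    (hI : LinQuot.IsMonomialIdeal I) (hd : LinQuot.GeneratedInDegree d I) :
    LinQuot.HasLinearQuotients I ↔
      LinQuot.IsDegreeGraded d I ∧ LinQuot.IsCLShellable (LinQuot.LcmLattice I) := by
  rcases eq_or_ne d 0 with rfl | h0
  · have := hd.subsingleton
    refine ⟨fun _ => ⟨⟨fun a b _ hab => ?_, fun a ha => ?_⟩,
      LinQuot.isCLShellable_of_subsingleton⟩, fun _ => hd.hasLinearQuotients_zero⟩
    · exact absurd (Subsingleton.elim a b) hab.lt.ne
    · exact absurd (Subsingleton.elim a ⊥) ha.1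
  constructor
  · rintro ⟨r, u, hinj, hrange, hcolon⟩
    have hu := LinQuot.LinearExchange.of_colon hcolon
    have hgr := hu.isDegreeGraded hrange hd h0
    exact ⟨hgr, LinQuot.isGradedPoset_of_isDegreeGraded hd (hrange ▸ Set.finite_range u) hgr,
      hu.exists_isRAO hinj hrange hd h0⟩
  · rintro ⟨hgr, -, t, a, ha⟩
    have hu := LinQuot.linearExchange_of_isRAO hgr ha
    have hr := ha.range_eq
    refine ⟨t, fun i => (a i).1, Subtype.val_injective.comp ha.injective, ?_, hu.colon⟩
    ext m
    refine ⟨?_, fun hm => ?_⟩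
    · rintro ⟨i, rfl⟩
      exact (hd.bot_covBy_iff h0).1 (hr.subset (Set.mem_range_self i))
    · obtain ⟨i, hi⟩ := hr.ge ((hd.bot_covBy_iff (a := LinQuot.LcmLattice.ofGen m hm) h0).2 hm)
      exact ⟨i, congrArg Subtype.val hi⟩
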